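/- **Localization game.** Let $G=(V,E)$ be a finite graph. In round $t=1,2,\dots$ the cops choose a set $S_t\subseteq V$ of exactly $k$ vertices (sensors), based on all the information they have received so far; then the invisible robber chooses her position $v_t$, where $v_1\in V$ is arbitrary and, for $t\ge 2$, $v_t$ is $v_{t-1}$ or a neighbour of $v_{t-1}$; then the cops learn the graph distances from $v_t$ to all $s\in S_t$ ($\infty$ between different components). The cops win in round $t$ if the information received in rounds $1,\dots,t$ determines $v_t$, that is, if every walk $(w_1,\dots,w_t)$ of the robber that yields the same information satisfies $w_t=v_t$. The localization number $\zeta(G)$ is the least $k$ such that the cops can guarantee, whatever the robber does, to win after finitely many rounds. **Random graph.** $\mathcal G(n,p)$ is the random graph on $n$ vertices in which every pair of vertices is an edge independently with probability $p$. All asymptotics are for $n\to\infty$, $f\ll g$ means $f=o(g)$, logarithms are natural, and "a.a.s." means with probability tending to $1$. **Theorem 6.1.** Let $p=p(n)\in[0,1]$ and $d=d(n):=pn$ with $\log n\ll d\ll n$. Let $i=i(n)\in\mathbb N$ be the largest integer with $d^i\ll n$: $d^{i}\ll n$, and every $j=j(n)\in\mathbb N$ with $d^{j}\ll n$ satisfies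 $j(n)\le i(n)$ for all large $n$. Suppose that $$\frac{d^{i+1}}{n}-2\log n\to\infty .$$ Then there is $\varepsilon(n)\to 0$ such that a.a.s. $$\zeta(\mathcal G(n,p))\le(1+\varepsilon(n))\,(\log d+2\log\log n)\,\frac{n}{d^{i}} .$$ -/

import Mathlib

open scoped Asymptotics

/-- The `S`-signature of the vertex `v`: the vector of graph distances from the sensors in `S`
to `v`. Distances are extended (`⊤` between different components), so that the definition also
makes sense on disconnected graphs. -/
noncomputable def signature {V : Type*} (G : SimpleGraph V) (S : Finset V) (v : V) :
    {s : V // s ∈ S} → ℕ∞ :=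
  fun s => G.edist s.1 v

/-- What the cops see in one round: the sensor locations and a vector of distances indexed by the
sensors. -/
abbrev Observation (V : Type*) : Type _ :=
  Σ S : Finset V, ({s : V // s ∈ S} → ℕ∞)

/-- A deterministic rule of the cops: from the list of all past observations it determines the
next set of sensor locations. -/
abbrev CopRule (V : Type*) : Type _ :=
  List (Observation V) → Finset V

/-- A walk of the robber in `G`, where in each step she may also stay where she is. -/
def IsRobberWalk {V : Type*} (G : SimpleGraph V) (w : ℕ → V) : Prop :=
  ∀ t, w (t + 1) = w t ∨ G.Adj (w t) (w (t + 1))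

/-- The sensor locations and signatures of the first `t` rounds (the info trail), if the cops play
by the rule `σ` and the robber is at `w j` in round `j`, for `j = 0, 1, 2, …`. -/
noncomputable def infoTrail {V : Type*} (G : SimpleGraph V) (σ : CopRule V) (w : ℕ → V) :
    ℕ → List (Observation V)
  | 0 => []
  | t + 1 => infoTrail G σ w t ++
      [⟨σ (infoTrail G σ w t), signature G (σ (infoTrail G σ w t)) (w t)⟩]

/-- The info trail up to and including round `t` suffices to determine the position in round `t`
of the robber who follows `w`: every walk with the same info trail is at the same vertex then. -/
def LocatedInRound {V : Type*} (G : SimpleGraph V) (σ : CopRule V) (w : ℕ → V) (t : ℕ) : Prop :=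
  ∀ x : ℕ → V, IsRobberWalk G x → infoTrail G σ x (t + 1) = infoTrail G σ w (t + 1) → x t = w t

/-- The cops can win the localization game on `G` with `k` sensors: some rule that always uses
exactly `k` sensors locates the robber in finite time, whatever walk she follows. -/
def CopsCanWin {V : Type*} (G : SimpleGraph V) (k : ℕ) : Prop :=
  ∃ σ : CopRule V, (∀ h, (σ h).card = k) ∧
    ∀ w : ℕ → V, IsRobberWalk G w → ∃ t, LocatedInRound G σ w t

/-- On a finite graph the cops win with a sensor on every vertex, so that the set of numbers of
sensors with which they win is not empty. -/
theorem copsCanWin_card {V : Type*} [Fintype V] (G : SimpleGraph V) :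
    CopsCanWin G (Fintype.card V) := by
  refine ⟨fun _ => Finset.univ, fun _ => rfl, fun w _ => ⟨0, fun x _ h => ?_⟩⟩
  simp only [infoTrail, List.nil_append, List.cons.injEq, and_true, Sigma.mk.injEq, true_and,
    heq_eq_eq] at h
  have h1 := congrFun h ⟨w 0, Finset.mem_univ _⟩
  simp only [signature, SimpleGraph.edist_self, SimpleGraph.edist_eq_zero_iff] at h1
  exact h1.symm

/-- The localization number of a finite graph: the least number of sensors with which the cops can
win the localization game. -/
noncomputable def localizationNumber {V : Type*} [Finite V] (G : SimpleGraph V) : ℕ :=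
  sInf {k : ℕ | CopsCanWin G k}

/-- The sequence of natural numbers `i` is (eventually) the largest one with `d ^ i ≪ n`. -/
def IsLargestExponent (d : ℕ → ℝ) (i : ℕ → ℕ) : Prop :=
  (fun n => d n ^ i n) =o[Filter.atTop] (fun n => (n : ℝ)) ∧
    ∀ j : ℕ → ℕ, (fun n => d n ^ j n) =o[Filter.atTop] (fun n => (n : ℝ)) →
      ∀ᶠ n in Filter.atTop, j n ≤ i n

/-! ### Independence of the edges of the binomial random graph. -/

open MeasureTheory ProbabilityTheory

/-! The cops keep track of the set `A` of possible positions of the robber. Suppose that any two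
vertices are told apart by at least `D` vertices. Then `k` random sensors leave on average at most
`|A|² (1 - D/n)^k` ordered pairs of `A` unresolved, so some choice does at least as well. A class `C
⊆ A` of two or more vertices with equal signatures satisfies `|C|² ≤ 2 |C| (|C| - 1)`, hence its
closed neighbourhood is smaller than `A` as soon as `2 Δ² (1 - D/n)^k < 1`, where `Δ` bounds the
closed neighbourhoods of single vertices. The candidates thus decrease in number until the robber is
located (`copsCanWin_of_separation`).

In the random graph `Δ ≤ 5d`, and `D` is about `2 d^i`: a sphere of radius `i` has at most `(1 +
o(1)) d^i` vertices about one vertex and at least `(2 - o(1)) d^i` about a pair, so most of the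
pair's sphere is at distance `i` from exactly one of the two (`two_mul_card_sphereAround_pair_le`).
Hence `k ≈ (log d + 2 log log n) n / d^i` suffices, the double logarithm absorbing the constants.

The sphere sizes come from exponential moments. Uncovering the graph by breadth-first search makes
each layer binomial given the past, so an exponential weight on the last layer can be pulled back,
layer by layer, to a weight on the starting set (`integral_exploration_succ_le`). Markov's
inequality then gives failure probability at most `n⁻⁴` per event, enough for a union bound over
pairs and radii. -/

/-- A function of a graph that depends only on the presence of the edges in `A`. -/
def DependsOnEdges {V α : Type*} (f : SimpleGraph V → α) (A : Set (Sym2 V)) : Prop :=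
  ∀ G H : SimpleGraph V, (∀ e ∈ A, e ∈ G.edgeSet ↔ e ∈ H.edgeSet) → f G = f H

namespace DependsOnEdges

variable {V α : Type*}

theorem const (a : α) (A : Set (Sym2 V)) : DependsOnEdges (fun _ : SimpleGraph V => a) A :=
  fun _ _ _ => rfl

theorem eq_of_edgeSet {f : SimpleGraph V → α} {A : Set (Sym2 V)} (h : DependsOnEdges f A)
    (G : SimpleGraph V) :
    f (SimpleGraph.fromEdgeSet {e | ∃ _ : e ∈ A, e ∈ G.edgeSet}) = f G := by
  apply h
  intro e he
  rw [SimpleGraph.edgeSet_fromEdgeSet]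
  simp only [Set.mem_sdiff, Set.mem_ofPred_eq, he, exists_true_left]
  exact ⟨fun h => h.1, fun h => ⟨h, fun hd => SimpleGraph.not_isDiag_of_mem_edgeSet G h hd⟩⟩

end DependsOnEdges

namespace SimpleGraph

instance instDiscreteMeasurableSpaceOfFinite {V : Type*} [Finite V] :
    DiscreteMeasurableSpace (SimpleGraph V) := by
  have : MeasurableSingletonClass (Set (Sym2 V)) := inferInstance
  refine ⟨fun s => ?_⟩
  rw [← Set.preimage_image_eq s edgeSet_injective]
  exact measurable_edgeSet (Set.toFinite _).measurableSet

variable {V : Type*} [Fintype V] (p : unitInterval)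

/-- The random graph is the image of a product measure under `fromEdgeSet`; each edge indicator
pulls back to a function of a single coordinate, cut off on the diagonal. -/
theorem iIndepFun_mem_edgeSet :
    iIndepFun (fun (e : Sym2 V) (G : SimpleGraph V) => e ∈ G.edgeSet) (binomialRandom V p) := by
  have hX : iIndepFun (fun (e : Sym2 V) (ω : Sym2 V → Prop) => ω e ∧ ¬ e.IsDiag)
      (Measure.infinitePi (fun i : Sym2 V ↦ unitInterval.toNNReal p •
        Measure.dirac (i ∈ (Sym2.diagSet : Set (Sym2 V))ᶜ)
        + unitInterval.toNNReal (unitInterval.symm p) • Measure.dirac False)) :=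
    iIndepFun_infinitePi (X := fun (e : Sym2 V) (x : Prop) => x ∧ ¬ e.IsDiag)
      (fun e => Measurable.of_discrete)
  rw [binomialRandom_eq_map, setBernoulli_eq_map, Measure.map_map (by fun_prop) (by fun_prop)]
  have hΦ : Measurable (fromEdgeSet ∘ fun p : Sym2 V → Prop => {i | p i}) := by fun_prop
  have hcomp : ∀ e : Sym2 V, (fun G : SimpleGraph V => e ∈ G.edgeSet) ∘
      (fromEdgeSet ∘ fun p : Sym2 V → Prop => {i | p i}) = fun ω => ω e ∧ ¬ e.IsDiag := by
    intro e
    ext ω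
    simp [Sym2.mem_diagSet]
  have := Measure.isProbabilityMeasure_map hΦ.aemeasurable (μ := Measure.infinitePi
    (fun i : Sym2 V ↦ unitInterval.toNNReal p •
        Measure.dirac (i ∈ (Sym2.diagSet : Set (Sym2 V))ᶜ)
        + unitInterval.toNNReal (unitInterval.symm p) • Measure.dirac False))
  classical
  rw [iIndepFun_iff_map_fun_eq_pi_map (fun e => Measurable.of_discrete.aemeasurable)] at hX ⊢
  rw [Measure.map_map .of_discrete hΦ]
  simp_rw [Measure.map_map (Measurable.of_discrete) hΦ, hcomp, ← hX]
  congr 1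
  ext ω e
  exact iff_of_eq (congrFun (hcomp e) ω)

theorem integral_mul_of_dependsOnEdges {f g : SimpleGraph V → ℝ} {A B : Set (Sym2 V)}
    (hf : DependsOnEdges f A) (hg : DependsOnEdges g B) (hAB : Disjoint A B) :
    ∫ G, f G * g G ∂(binomialRandom V p) =
      (∫ G, f G ∂(binomialRandom V p)) * ∫ G, g G ∂(binomialRandom V p) := by
  classical
  have h := (iIndepFun_mem_edgeSet (V := V) p).indepFun_finset A.toFinset B.toFinset
    (by simpa using hAB) (fun i => Measurable.of_discrete)
  let F : (A.toFinset → Prop) → ℝ := fun t =>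
    f (fromEdgeSet {e | ∃ h : e ∈ A, t ⟨e, by simpa using h⟩})
  let K : (B.toFinset → Prop) → ℝ := fun t =>
    g (fromEdgeSet {e | ∃ h : e ∈ B, t ⟨e, by simpa using h⟩})
  have h' := h.comp (φ := F) (ψ := K) Measurable.of_discrete Measurable.of_discrete
  have e1 : (F ∘ fun G (e : A.toFinset) => (e : Sym2 V) ∈ G.edgeSet) = f :=
    funext fun G => hf.eq_of_edgeSet G
  have e2 : (K ∘ fun G (e : B.toFinset) => (e : Sym2 V) ∈ G.edgeSet) = g :=
    funext fun G => hg.eq_of_edgeSet G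
  rw [e1, e2] at h'
  exact h'.integral_fun_mul_eq_mul_integral
    Measurable.of_discrete.aestronglyMeasurable Measurable.of_discrete.aestronglyMeasurable

theorem integral_prod_of_dependsOnEdges {ι : Type*} (s : Finset ι) {f : ι → SimpleGraph V → ℝ}
    {A : ι → Set (Sym2 V)} (hf : ∀ i ∈ s, DependsOnEdges (f i) (A i))
    (hA : (s : Set ι).PairwiseDisjoint A) :
    ∫ G, ∏ i ∈ s, f i G ∂(binomialRandom V p) = ∏ i ∈ s, ∫ G, f i G ∂(binomialRandom V p) := by
  classical
  induction s using Finset.induction_on with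
  | empty => simp
  | insert a s ha ih =>
    simp only [Finset.prod_insert ha]
    rw [← ih (fun i hi => hf i (Finset.mem_insert_of_mem hi))
      (hA.subset (by simp))]
    refine integral_mul_of_dependsOnEdges p (A := A a) (B := ⋃ i ∈ s, A i)
      (hf a (Finset.mem_insert_self _ _)) ?_ ?_
    · intro G H h
      refine Finset.prod_congr rfl fun i hi => ?_
      exact hf i (Finset.mem_insert_of_mem hi) G H fun e he =>
        h e (Set.mem_biUnion (by exact hi) he)
    · rw [Set.disjoint_iUnion₂_right]
      intro i hi
      exact hA (by simp) (by simp [hi]) (fun h => ha (h ▸ hi))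

theorem binomialRandom_real_adj {x y : V} (hxy : x ≠ y) :
    (binomialRandom V p).real {G | G.Adj x y} = p := by
  rw [binomialRandom_eq_map, setBernoulli_eq_map, Measure.map_map (by fun_prop) (by fun_prop),
    map_measureReal_apply (by fun_prop) (MeasurableSet.of_discrete)]
  have : ((fromEdgeSet ∘ fun p : Sym2 V → Prop => {i | p i}) ⁻¹' {G : SimpleGraph V | G.Adj x y}) =
      (cylinder (α := fun _ : Sym2 V => Prop) {s(x, y)} {fun _ => True}) := by
    ext; simp [funext_iff, hxy]
  rw [this, measureReal_def, Measure.infinitePi_cylinder _ (MeasurableSet.of_discrete)]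
  simp [hxy, Measure.pi_singleton]

theorem integral_ite_adj {x y : V} (hxy : x ≠ y) [∀ G : SimpleGraph V, Decidable (G.Adj x y)] :
    ∫ G : SimpleGraph V, (if G.Adj x y then (0 : ℝ) else 1) ∂(binomialRandom V p) = 1 - p := by
  have : (fun G : SimpleGraph V => if G.Adj x y then (0 : ℝ) else 1) =
      fun G => 1 - Set.indicator {G : SimpleGraph V | G.Adj x y} 1 G := by
    ext G
    by_cases h : G.Adj x y <;> simp [h]
  rw [this, integral_sub (.of_finite) (.of_finite), integral_indicator_one .of_discrete,
    binomialRandom_real_adj p hxy]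
  simp

end SimpleGraph

/-! ### Breadth-first exploration and exponential moments of its layers. -/

namespace SimpleGraph

variable {V : Type*} [Fintype V]

open Classical in
/-- The neighbours outside of `b` of the vertices in `s`. -/
noncomputable def outerNeighbors (G : SimpleGraph V) (b s : Finset V) : Finset V :=
  {y | y ∉ b ∧ ∃ x ∈ s, G.Adj x y}

open Classical in
/-- The value `∏ j ≤ i, c (i - j) s_j` where `s_0, s_1, …, s_i` are the layers of the breadth-first
exploration that starts with the layer `s`, the set `b` of vertices having been explored. -/
noncomputable def exploration (c : ℕ → Finset V → ℝ) (G : SimpleGraph V) :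
    ℕ → Finset V → Finset V → ℝ
  | 0, _, s => c 0 s
  | j + 1, b, s => c (j + 1) s *
      exploration c G j (b ∪ G.outerNeighbors b s) (G.outerNeighbors b s)

theorem mem_outerNeighbors {G : SimpleGraph V} {b s : Finset V} {y : V} :
    y ∈ G.outerNeighbors b s ↔ y ∉ b ∧ ∃ x ∈ s, G.Adj x y := by
  simp [outerNeighbors]

theorem disjoint_outerNeighbors (G : SimpleGraph V) (b s : Finset V) :
    Disjoint (G.outerNeighbors b s) b :=
  Finset.disjoint_left.2 fun _ h => (mem_outerNeighbors.1 h).1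

theorem outerNeighbors_congr {G H : SimpleGraph V} {b s : Finset V}
    (h : ∀ x ∈ s, ∀ y ∉ b, s(x, y) ∈ G.edgeSet ↔ s(x, y) ∈ H.edgeSet) :
    G.outerNeighbors b s = H.outerNeighbors b s := by
  ext y
  simp only [mem_outerNeighbors]
  refine and_congr_right fun hy => exists_congr fun x => and_congr_right fun hx => ?_
  simpa using h x hx y hy

open Classical in
-- Every inspected edge joins the current layer, which is disjoint from `a`, to a vertex outside of
-- `b ⊇ a`. With `a` the vertices explored before `s`, the rest of the search is independent of the
-- edges at `a`.
theorem dependsOnEdges_exploration (c : ℕ → Finset V → ℝ) (j : ℕ) (b s a : Finset V)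
    (hsb : s ⊆ b) (has : Disjoint a s) (hab : a ⊆ b) :
    DependsOnEdges (fun G => exploration c G j b s) {e | ∀ x ∈ e, x ∉ a} := by
  induction j generalizing b s a with
  | zero => exact DependsOnEdges.const _ _
  | succ j ih =>
    intro G H hGH
    have hN : G.outerNeighbors b s = H.outerNeighbors b s := by
      refine outerNeighbors_congr fun x hx y hy => hGH _ ?_
      simp only [Set.mem_ofPred_eq, Sym2.mem_iff]
      rintro z (rfl | rfl)
      · exact fun h => Finset.disjoint_left.1 has h hx
      · exact fun h => hy (hab h)
    simp only [exploration, hN]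
    congr 1
    exact ih _ _ a Finset.subset_union_right
      ((H.disjoint_outerNeighbors b s).symm.mono_left hab)
      (hab.trans Finset.subset_union_left) G H hGH

variable (p : unitInterval)

open Classical in
-- Deferred decisions: split by the value `t` of the next layer. That event is decided by edges
-- meeting `b`, the remaining search by edges avoiding `b`, so the expectations factor.
theorem integral_exploration_succ_le (c : ℕ → Finset V → ℝ) (g : Finset V → ℝ) (j : ℕ)
    {b s : Finset V} (hsb : s ⊆ b) (hc : 0 ≤ c (j + 1) s)
    (hg : ∀ t, Disjoint t b → ∫ G, exploration c G j (b ∪ t) t ∂(binomialRandom V p) ≤ g t) :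
    ∫ G, exploration c G (j + 1) b s ∂(binomialRandom V p) ≤
      c (j + 1) s * ∫ G, g (outerNeighbors G b s) ∂(binomialRandom V p) := by
  simp only [exploration]
  rw [integral_const_mul]
  refine mul_le_mul_of_nonneg_left ?_ hc
  have split (F : SimpleGraph V → Finset V → ℝ) (G : SimpleGraph V) :
      F G (outerNeighbors G b s) =
        ∑ t, (if outerNeighbors G b s = t then (1 : ℝ) else 0) * F G t := by
    simp
  rw [integral_congr_ae (.of_forall fun G => split (fun G t => exploration c G j (b ∪ t) t) G),
    integral_congr_ae (.of_forall fun G => split (fun _ t => g t) G),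
    integral_finsetSum _ fun _ _ => .of_finite, integral_finsetSum _ fun _ _ => .of_finite]
  refine Finset.sum_le_sum fun t _ => ?_
  by_cases ht : Disjoint t b
  · have hI : DependsOnEdges (fun G => if outerNeighbors G b s = t then (1 : ℝ) else 0)
        {e | ∀ x ∈ e, x ∉ b}ᶜ := by
      intro G H hGH
      have : outerNeighbors G b s = outerNeighbors H b s :=
        outerNeighbors_congr fun x hx y _ => hGH _ (by
          simp only [Set.mem_compl_iff, Set.mem_ofPred_eq]
          exact fun h => h x (by simp) (hsb hx))
      simp only [this]
    rw [integral_mul_of_dependsOnEdges p hI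
      (dependsOnEdges_exploration c j (b ∪ t) t b Finset.subset_union_right ht.symm
        Finset.subset_union_left) disjoint_compl_left, integral_mul_const]
    exact mul_le_mul_of_nonneg_left (hg t ht) (integral_nonneg fun G => by positivity)
  · have : ∀ G : SimpleGraph V, outerNeighbors G b s ≠ t := fun G h =>
      ht (h ▸ G.disjoint_outerNeighbors b s)
    simp [this]

open Classical in
theorem integral_notMem_outerNeighbors {b s : Finset V} (hsb : s ⊆ b) {y : V} (hy : y ∉ b) :
    ∫ G, (if y ∈ outerNeighbors G b s then (0 : ℝ) else 1) ∂(binomialRandom V p) =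
      (1 - p) ^ s.card := by
  have h1 (G : SimpleGraph V) : (if y ∈ outerNeighbors G b s then (0 : ℝ) else 1) =
      ∏ x ∈ s, if G.Adj x y then (0 : ℝ) else 1 := by
    split_ifs with h
    · obtain ⟨_, x, hx, hxy⟩ := mem_outerNeighbors.1 h
      exact (Finset.prod_eq_zero hx (by simp [hxy])).symm
    · refine (Finset.prod_eq_one fun x hx => ?_).symm
      rw [if_neg]
      exact fun hxy => h (mem_outerNeighbors.2 ⟨hy, x, hx, hxy⟩)
  simp_rw [h1]
  rw [integral_prod_of_dependsOnEdges p s (A := fun x => {s(x, y)})]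
  · rw [Finset.prod_congr rfl fun x hx => integral_ite_adj p (fun h : x = y => hy (h ▸ hsb hx)),
      Finset.prod_const]
  · intro x _ G H h
    have := h s(x, y) rfl
    simp only [mem_edgeSet] at this
    simp [this]
  · intro x hx x' hx' hne
    simp only [Function.onFun, Set.disjoint_singleton]
    intro h
    rcases Sym2.eq_iff.1 h with h | h
    · exact hne h.1
    · exact hy (h.1 ▸ hsb hx)

open Classical in
-- The vertices outside of `b` join the layer independently, because their edge sets to `s` are
-- disjoint; this is the moment generating function of a binomial variable.
theorem integral_exp_card_outerNeighbors (a : ℝ) {b s : Finset V} (hsb : s ⊆ b) :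
    ∫ G, Real.exp (a * (outerNeighbors G b s).card) ∂(binomialRandom V p) =
      (1 + (1 - (1 - (p : ℝ)) ^ s.card) * (Real.exp a - 1)) ^ (Finset.card bᶜ) := by
  have h1 (G : SimpleGraph V) : Real.exp (a * (outerNeighbors G b s).card) =
      ∏ y ∈ bᶜ, (Real.exp a +
        (1 - Real.exp a) * if y ∈ outerNeighbors G b s then (0 : ℝ) else 1) := by
    have : ∀ y, (Real.exp a + (1 - Real.exp a) * if y ∈ outerNeighbors G b s then (0 : ℝ) else 1) =
        if y ∈ outerNeighbors G b s then Real.exp a else 1 := by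
      intro y; split_ifs <;> ring
    simp_rw [this]
    rw [Finset.prod_ite, Finset.prod_const, Finset.prod_const_one, mul_one, mul_comm,
      Real.exp_nat_mul]
    congr 2
    ext y
    simp only [Finset.mem_filter, Finset.mem_compl]
    exact ⟨fun h => ⟨(mem_outerNeighbors.1 h).1, h⟩, fun h => h.2⟩
  simp_rw [h1]
  rw [integral_prod_of_dependsOnEdges p bᶜ (A := fun y => {e | ∃ x ∈ s, e = s(x, y)})]
  · rw [← Finset.prod_const]
    refine Finset.prod_congr rfl fun y hy => ?_
    rw [integral_add .of_finite .of_finite, integral_const_mul,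
      integral_notMem_outerNeighbors p hsb (Finset.mem_compl.1 hy)]
    simp
    ring
  · intro y _ G H h
    have : y ∈ outerNeighbors G b s ↔ y ∈ outerNeighbors H b s := by
      simp only [mem_outerNeighbors]
      refine and_congr_right fun hy => exists_congr fun x => and_congr_right fun hx => ?_
      simpa using h s(x, y) ⟨x, hx, rfl⟩
    simp only [this]
  · intro y hy y' hy' hne
    simp only [Finset.coe_compl, Set.mem_compl_iff, Finset.mem_coe] at hy hy'
    refine Set.disjoint_left.2 ?_
    rintro e ⟨x, hx, rfl⟩ ⟨x', hx', h⟩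
    rcases Sym2.eq_iff.1 h with h | h
    · exact hne h.2
    · exact hy' (h.1 ▸ hsb hx)

theorem integral_exp_card_outerNeighbors_le {a : ℝ} (ha : 0 ≤ a) {b s : Finset V} (hsb : s ⊆ b) :
    ∫ G, Real.exp (a * (outerNeighbors G b s).card) ∂(binomialRandom V p) ≤
      Real.exp ((p : ℝ) * Fintype.card V * (Real.exp a - 1) * s.card) := by
  classical
  rw [integral_exp_card_outerNeighbors p a hsb]
  have hp0 := p.2.1
  have hp1 := p.2.2
  have he : 0 ≤ Real.exp a - 1 := by linarith [Real.one_le_exp ha]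
  have hq : 1 - (1 - (p : ℝ)) ^ s.card ≤ (p : ℝ) * s.card := by
    have := one_add_mul_le_pow (a := -(p : ℝ)) (by linarith) s.card
    rw [← sub_eq_add_neg] at this
    linarith
  have hq0 : 0 ≤ 1 - (1 - (p : ℝ)) ^ s.card := by
    have := pow_le_one₀ (n := s.card) (by linarith) (by linarith : 1 - (p : ℝ) ≤ 1)
    linarith
  calc _ ≤ (1 + (1 - (1 - (p : ℝ)) ^ s.card) * (Real.exp a - 1)) ^ Fintype.card V :=
        pow_le_pow_right₀ (by nlinarith) (Finset.card_le_univ _)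
    _ ≤ (Real.exp ((p : ℝ) * s.card * (Real.exp a - 1))) ^ Fintype.card V := by
        refine pow_le_pow_left₀ (by positivity) ?_ _
        rw [add_comm]
        exact (add_le_add_left (mul_le_mul_of_nonneg_right hq he) 1).trans (Real.add_one_le_exp _)
    _ = _ := by rw [← Real.exp_nat_mul]; ring_nf

theorem integral_exp_neg_card_outerNeighbors_le {a β : ℝ} (ha : 0 ≤ a) {b s : Finset V}
    (hsb : s ⊆ b) (hβ : (b.card : ℝ) ≤ β) (hs : (p : ℝ) * s.card ≤ (1 : ℝ)) :
    ∫ G, Real.exp (-a * (outerNeighbors G b s).card) ∂(binomialRandom V p) ≤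
      Real.exp (-((p : ℝ) * (Fintype.card V - β) * (1 - Real.exp (-a)) * (1 - (p : ℝ) * s.card) * s.card)) := by
  classical
  rw [integral_exp_card_outerNeighbors p (-a) hsb]
  have hp0 := p.2.1
  have hp1 := p.2.2
  have hM : (Fintype.card V : ℝ) - β ≤ (bᶜ.card : ℝ) := by
    rw [Finset.card_compl, Nat.cast_sub (Finset.card_le_univ _)]
    linarith
  set w := 1 - Real.exp (-a) with hw
  have hw0 : 0 ≤ w := by
    have := Real.exp_le_one_iff.2 (neg_nonpos.2 ha)
    linarith
  have hw1 : w ≤ 1 := by linarith [Real.exp_pos (-a)]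
  set q := 1 - (1 - (p : ℝ)) ^ s.card with hq
  have hx0 : 0 ≤ (p : ℝ) * (s.card : ℝ) := by positivity
  have hpow : (1 - (p : ℝ)) ^ s.card ≤ Real.exp (-((p : ℝ) * s.card)) := by
    calc _ ≤ Real.exp (-p) ^ s.card :=
          pow_le_pow_left₀ (by linarith) (by linarith [Real.add_one_le_exp (-(p : ℝ))]) _
      _ = _ := by rw [← Real.exp_nat_mul]; ring_nf
  -- With `x = p |s|`, this is `1 ≤ (1 + x) (1 - x + x²) = 1 + x³` combined with `1 + x ≤ exp x`.
  have hexp : Real.exp (-((p : ℝ) * s.card : ℝ)) ≤ 1 - (p : ℝ) * s.card + ((p : ℝ) * s.card) ^ 2 := by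
    have h1 := Real.add_one_le_exp ((p : ℝ) * s.card : ℝ)
    rw [Real.exp_neg, inv_le_iff_one_le_mul₀ (Real.exp_pos _)]
    have h2 : (0 : ℝ) ≤ 1 - (p : ℝ) * s.card + ((p : ℝ) * s.card) ^ 2 := by nlinarith
    nlinarith [mul_le_mul_of_nonneg_left h1 h2, pow_nonneg hx0 3]
  have hqr : (p : ℝ) * s.card * (1 - (p : ℝ) * s.card) ≤ q := by nlinarith
  have hr : 0 ≤ (p : ℝ) * s.card * (1 - (p : ℝ) * s.card : ℝ) := mul_nonneg hx0 (by linarith)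
  have hq1 : q ≤ 1 := by
    have : 0 ≤ (1 - (p : ℝ)) ^ s.card := pow_nonneg (by linarith) _
    linarith
  calc (1 + q * (Real.exp (-a) - 1)) ^ bᶜ.card ≤ Real.exp (-(q * w)) ^ bᶜ.card := by
        refine pow_le_pow_left₀ (by nlinarith) ?_ _
        have := Real.add_one_le_exp (-(q * w))
        nlinarith
    _ = Real.exp (-(q * w * bᶜ.card)) := by rw [← Real.exp_nat_mul]; ring_nf
    _ ≤ _ := by
        refine Real.exp_le_exp.2 (neg_le_neg ?_)
        calc _ = ((p : ℝ) * s.card * (1 - (p : ℝ) * s.card) * w) * ((Fintype.card V : ℝ) - β) := by ring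
          _ ≤ ((p : ℝ) * s.card * (1 - (p : ℝ) * s.card) * w) * bᶜ.card :=
            mul_le_mul_of_nonneg_left hM (mul_nonneg hr hw0)
          _ ≤ _ := by gcongr

/-- The layers of the breadth-first exploration that starts with the layer `s`, the set `b` of
vertices having been explored. -/
noncomputable def layer [DecidableEq V] (G : SimpleGraph V) : ℕ → Finset V → Finset V → Finset V
  | 0, _, s => s
  | j + 1, b, s => layer G j (b ∪ G.outerNeighbors b s) (G.outerNeighbors b s)

open Classical in
theorem exploration_one (c : Finset V → ℝ) (G : SimpleGraph V) (j : ℕ) (b s : Finset V) :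
    exploration (fun j => if j = 0 then c else 1) G j b s = c (G.layer j b s) := by
  induction j generalizing b s with
  | zero => simp [exploration, layer]
  | succ j ih => simp [exploration, layer, ih]

open Classical in
-- The weights are indexed by the number of layers still to come, hence the cap `K (j - l)` on layer
-- `l`.
theorem exploration_indicator {c : Finset V → ℝ} (K : ℕ → ℝ) (G : SimpleGraph V) (j : ℕ)
    (b s : Finset V) (h : ∀ l < j, ((G.layer l b s).card : ℝ) ≤ K (j - l)) :
    exploration (fun j s => if j = 0 then c s else if (s.card : ℝ) ≤ K j then 1 else 0) G j b s =
      c (G.layer j b s) := by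
  induction j generalizing b s with
  | zero => simp [exploration, layer]
  | succ j ih =>
    have h0 := h 0 (by omega)
    simp only [layer, Nat.sub_zero] at h0
    simp only [exploration, layer, h0, if_true, one_mul, Nat.add_eq_zero_iff, one_ne_zero, and_false,
      if_false]
    refine ih _ _ fun l hl => ?_
    have := h (l + 1) (by omega)
    rwa [Nat.add_sub_add_right] at this

open Classical in
theorem integral_exp_card_layer_le (μ : ℕ → ℝ) (j : ℕ) (hμ0 : ∀ l < j, 0 ≤ μ l)
    (hμ : ∀ l < j, (p : ℝ) * Fintype.card V * (Real.exp (μ l) - 1) ≤ μ (l + 1)) {b s : Finset V}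
    (hsb : s ⊆ b) :
    ∫ G, Real.exp (μ 0 * (layer G j b s).card) ∂(binomialRandom V p) ≤
      Real.exp (μ j * s.card) := by
  simp_rw [← exploration_one (fun s => Real.exp (μ 0 * s.card))]
  induction j generalizing b s with
  | zero => simp [exploration]
  | succ j ih =>
    refine (integral_exploration_succ_le p _ (fun t => Real.exp (μ j * t.card)) j hsb (by simp)
      fun t _ => ih (fun l hl => hμ0 l (by omega)) (fun l hl => hμ l (by omega))
        Finset.subset_union_right).trans ?_
    simp only [Nat.add_eq_zero_iff, one_ne_zero, and_false, if_false, Pi.one_apply, one_mul]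
    refine (integral_exp_card_outerNeighbors_le p (hμ0 j (by omega)) hsb).trans ?_
    exact Real.exp_le_exp.2 (mul_le_mul_of_nonneg_right (hμ j (by omega)) (by positivity))

open Classical in
-- A negative exponent needs a layer that is likely to be large, which fails if too many vertices
-- are used up or share neighbours. The indicators with caps `K` exclude this; `β l` bounds the
-- vertices explored before the layer with `l` layers to come.
theorem integral_exploration_le (ν K β : ℕ → ℝ) (j : ℕ) (hν0 : ∀ l < j, 0 ≤ ν l)
    (hK : ∀ l < j, (p : ℝ) * K (l + 1) ≤ (1 : ℝ)) (hβ : ∀ l < j, β (l + 1) + K (l + 1) ≤ β l)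
    (hβn : ∀ l < j, β l ≤ Fintype.card V)
    (hν : ∀ l < j, ν (l + 1) ≤
      (p : ℝ) * (Fintype.card V - β l) * (1 - Real.exp (-ν l)) * (1 - (p : ℝ) * K (l + 1)))
    {b s : Finset V} (hsb : s ⊆ b) (hb : ((b \ s).card : ℝ) ≤ β j) :
    ∫ G, exploration (fun j s => if j = 0 then Real.exp (-ν 0 * s.card) else
        if (s.card : ℝ) ≤ K j then 1 else 0) G j b s ∂(binomialRandom V p) ≤
      Real.exp (-ν j * s.card) := by
  induction j generalizing b s with
  | zero => simp [exploration]
  | succ j ih =>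
    have hp0 := p.2.1
    by_cases hs : (s.card : ℝ) ≤ K (j + 1)
    · have hbcard : (b.card : ℝ) ≤ β j := by
        have h1 := Finset.card_sdiff_add_card_eq_card hsb
        have h2 : ((b \ s).card : ℝ) + s.card = b.card := by exact_mod_cast h1
        linarith [hβ j (by omega)]
      have hps : (p : ℝ) * s.card ≤ (p : ℝ) * K (j + 1) := mul_le_mul_of_nonneg_left hs hp0
      have hw : 0 ≤ 1 - Real.exp (-ν j) := by
        have := Real.exp_le_one_iff.2 (neg_nonpos.2 (hν0 j (by omega)))
        linarith
      refine (integral_exploration_succ_le p _ (fun t => Real.exp (-ν j * t.card)) j hsb ?_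
        fun t ht => ih (fun l hl => hν0 l (by omega)) (fun l hl => hK l (by omega))
          (fun l hl => hβ l (by omega)) (fun l hl => hβn l (by omega)) (fun l hl => hν l (by omega))
          Finset.subset_union_right ?_).trans ?_
      · simp [hs]
      · rwa [Finset.union_sdiff_cancel_right ht.symm]
      · simp only [Nat.add_eq_zero_iff, one_ne_zero, and_false, if_false, hs, if_true, one_mul]
        refine (integral_exp_neg_card_outerNeighbors_le p (hν0 j (by omega)) hsb hbcard
          (hps.trans (hK j (by omega)))).trans ?_
        rw [neg_mul]
        refine Real.exp_le_exp.2 (neg_le_neg ?_)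
        refine mul_le_mul_of_nonneg_right ?_ (by positivity)
        refine (hν j (by omega)).trans ?_
        refine mul_le_mul_of_nonneg_left (by linarith) ?_
        exact mul_nonneg (mul_nonneg hp0 (by linarith [hβn j (by omega)])) hw
    · simp only [exploration, hs, if_false, Nat.add_eq_zero_iff, one_ne_zero, and_false, zero_mul,
        integral_zero]
      positivity


/-! ### Tail bounds for the sizes of the layers. -/

open Classical in
theorem exploration_nonneg {c : ℕ → Finset V → ℝ} (hc : ∀ j s, 0 ≤ c j s) (G : SimpleGraph V)
    (j : ℕ) (b s : Finset V) : 0 ≤ exploration c G j b s := by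
  induction j generalizing b s with
  | zero => exact hc _ _
  | succ j ih => exact mul_nonneg (hc _ _) (ih _ _)

theorem binomialRandom_real_le_of_forall_le {f : SimpleGraph V → ℝ} (hf : ∀ G, 0 ≤ f G) {c : ℝ}
    (hc : 0 < c) {s : Set (SimpleGraph V)} (h : ∀ G ∈ s, c ≤ f G) {B : ℝ}
    (hB : ∫ G, f G ∂(binomialRandom V p) ≤ B) : (binomialRandom V p).real s ≤ B / c := by
  rw [le_div_iff₀' hc]
  refine le_trans ?_ ((mul_meas_ge_le_integral_of_nonneg (.of_forall hf) .of_finite c).trans hB)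
  exact mul_le_mul_of_nonneg_left (measureReal_mono h) hc.le

open Classical in
theorem binomialRandom_real_le_card_layer {d θ R : ℝ} (hd : d = p * Fintype.card V) (hd8 : 8 ≤ d)
    (hθ : 0 ≤ θ) (hθd : θ ≤ d) (i : ℕ) {b s : Finset V} (hsb : s ⊆ b) :
    (binomialRandom V p).real {G | R * d ^ i ≤ ((layer G i b s).card : ℝ)} ≤
      Real.exp (θ * (1 + 4 * θ / d) * s.card - θ * R) := by
  have hd0 : 0 < d := by linarith
  -- This solves the linearised recursion `x (l + 1) = d * x l` with `x i = θ`; the factor `1 + 4 *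
  -- x l / d` used below pays for the quadratic terms of `exp`.
  set x : ℕ → ℝ := fun l => θ * d ^ l / d ^ i with hx
  have hx0 l : 0 ≤ x l := by positivity
  have hxs l : x (l + 1) = d * x l := by simp only [hx, pow_succ]; ring
  have hxi : x i = θ := by simp only [hx]; field_simp
  have hx1 l (hl : l < i) : x l ≤ 1 := by
    simp only [hx]
    rw [div_le_one (by positivity)]
    calc θ * d ^ l ≤ d * d ^ l := by gcongr
      _ = d ^ (l + 1) := by ring
      _ ≤ d ^ i := pow_le_pow_right₀ (by linarith) hl
  have hμ0 l : 0 ≤ x l * (1 + 4 * x l / d) :=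
    mul_nonneg (hx0 l) (by have := hx0 l; positivity)
  have key := integral_exp_card_layer_le p (fun l => x l * (1 + 4 * x l / d)) i
    (fun l _ => hμ0 l) ?_ hsb
  · have := binomialRandom_real_le_of_forall_le p (c := Real.exp (θ * R))
      (s := {G | R * d ^ i ≤ ((layer G i b s).card : ℝ)}) (fun _ => (Real.exp_pos _).le)
      (Real.exp_pos _) ?_ key
    · rwa [← Real.exp_sub, hxi] at this
    · intro G hG
      refine Real.exp_le_exp.2 ?_
      have h1 : x 0 ≤ x 0 * (1 + 4 * x 0 / d) := by
        have : 0 ≤ 4 * x 0 / d := by have := hx0 0; positivity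
        nlinarith [hx0 0]
      calc θ * R = x 0 * (R * d ^ i) := by simp only [hx]; field_simp
        _ ≤ x 0 * (layer G i b s).card := mul_le_mul_of_nonneg_left hG (hx0 0)
        _ ≤ _ := mul_le_mul_of_nonneg_right h1 (by positivity)
  · intro l hl
    rw [← hd, hxs]
    have hxl0 := hx0 l
    have hxl1 := hx1 l hl
    generalize x l = y at *
    have hyd : 0 ≤ y / d := by positivity
    have hyd8 : y / d ≤ 1 / 8 := by rw [div_le_iff₀ hd0]; linarith
    have hm0 : 0 ≤ y * (1 + 4 * y / d) := by positivity
    have hm2 : y * (1 + 4 * y / d) ≤ 3 / 2 := by rw [mul_div_assoc]; nlinarith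
    have hexp : Real.exp (y * (1 + 4 * y / d)) - 1 ≤
        y * (1 + 4 * y / d) * (1 + 2 * y) := by
      have hm3 : y * (1 + 4 * y / d) ≤ 3 / 2 * y := by rw [mul_div_assoc]; nlinarith
      generalize y * (1 + 4 * y / d) = m at *
      -- The quadratic estimate needs an argument of size at most 1, while `m` may reach `3 / 2`; so
      -- it is applied to `m / 2` and squared.
      have h1 := (abs_le.1 (Real.abs_exp_sub_one_sub_id_le (x := m / 2)
        (by rw [abs_le]; constructor <;> linarith))).2
      have h2 : Real.exp m = Real.exp (m / 2) * Real.exp (m / 2) := by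
        rw [← Real.exp_add]; ring_nf
      have h3 : Real.exp (m / 2) ≤ 1 + m / 2 + (m / 2) ^ 2 := by linarith
      rw [h2]
      have h4 := mul_le_mul h3 h3 (Real.exp_pos _).le (by positivity)
      have h5 : m ^ 3 ≤ 3 / 2 * m ^ 2 := by nlinarith [sq_nonneg m]
      have h6 : m ^ 4 ≤ 9 / 4 * m ^ 2 := by nlinarith [sq_nonneg m]
      nlinarith
    have e : d * y * (1 + 4 * (d * y) / d) = d * (y * (1 + 4 * y)) := by field_simp
    rw [e]
    refine mul_le_mul_of_nonneg_left (hexp.trans ?_) hd0.le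
    rw [mul_assoc, mul_div_assoc]
    refine mul_le_mul_of_nonneg_left ?_ hxl0
    have hyd' : y / d ≤ y / 8 := div_le_div_of_nonneg_left hxl0 (by norm_num) hd8
    nlinarith [mul_le_mul_of_nonneg_right hyd8 hxl0]

/-- One step of the lower-tail recursion, with `h = 2⁻ˡ` and `z = d⁻ˡ`. The exploration losses are
at most `5 * η * h`, exactly the growth of `10 * η * (1 - h)` when `h` is halved, so they never add
up to more than `10 * η`. -/
theorem exp_neg_recursion {d x η h z ν : ℝ} (hd : 8 ≤ d) (hx0 : 0 ≤ x) (hx1 : x ≤ 1)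
    (hη0 : 0 ≤ η) (hη1 : η ≤ 1 / 20) (hh0 : 0 ≤ h) (hh1 : h ≤ 1) (hz0 : 0 ≤ z) (hz : z ≤ h)
    (hν : ν = x * (1 - 4 * x / d - 10 * η * (1 - h))) :
    x * (1 - 4 * x - 10 * η * (1 - h / 2)) ≤
      (1 - 8 / d * (η * z)) * (1 - 4 * η * z) * (1 - Real.exp (-ν)) := by
  have hd0 : 0 < d := by linarith
  have h8 : 8 / d ≤ 1 := by rw [div_le_one hd0]; exact hd
  have h80 : 0 ≤ 8 / d := by positivity
  have hv0 : 0 ≤ 4 * x / d := by positivity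
  have hv : 4 * x / d ≤ x := by rw [div_le_iff₀ hd0]; nlinarith
  have hv1 : 4 * x / d ≤ 1 / 2 := by rw [div_le_iff₀ hd0]; linarith
  have hw0 : 0 ≤ 10 * η * (1 - h) := mul_nonneg (by positivity) (by linarith)
  have hw1 : 10 * η * (1 - h) ≤ 1 / 2 := by nlinarith
  have hy0 : 0 ≤ η * h := by positivity
  have hzy : η * z ≤ η * h := mul_le_mul_of_nonneg_left hz hη0
  have hz0' : 0 ≤ η * z := by positivity
  have hy1 : η * h ≤ 1 / 20 := by nlinarith
  have e : 10 * η * (1 - h / 2) = 10 * η * (1 - h) + 5 * (η * h) := by ring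
  rw [e, mul_assoc 4]
  generalize 10 * η * (1 - h) = w at *
  generalize η * h = y at *
  generalize η * z = u at *
  generalize 4 * x / d = v at *
  generalize 8 / d = r at *
  have hA : 0 ≤ 1 - v - w := by linarith
  have hA1 : 1 - v - w ≤ 1 := by linarith
  have hν0 : 0 ≤ ν := hν ▸ mul_nonneg hx0 hA
  have hνx : ν ≤ x := hν ▸ mul_le_of_le_one_right hx0 hA1
  have hexp : ν * (1 - x) ≤ 1 - Real.exp (-ν) := by
    have h2 := (abs_le.1 (Real.abs_exp_sub_one_sub_id_le (x := -ν)
      (by rw [abs_le]; constructor <;> linarith))).2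
    nlinarith
  have hfac : 1 - 5 * y ≤ (1 - r * u) * (1 - 4 * u) := by
    nlinarith [mul_nonneg h80 hz0', mul_nonneg (mul_nonneg h80 hz0') hz0']
  have hfin : x * (1 - 4 * x - (w + 5 * y)) ≤ (1 - 5 * y) * (ν * (1 - x)) := by
    have h1 : 0 ≤ 5 * y * x * (1 - v - w) := mul_nonneg (by positivity) hA
    have h2 : (5 * y + x) * (1 - v - w) ≤ 5 * y + x :=
      mul_le_of_le_one_right (by positivity) hA1
    rw [hν, mul_assoc x, mul_left_comm _ x]
    refine mul_le_mul_of_nonneg_left ?_ hx0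
    linarith
  exact hfin.trans (mul_le_mul hfac hexp (mul_nonneg hν0 (by linarith)) ((by linarith : (0 : ℝ) ≤
    1 - 5 * y).trans hfac))

open Classical in
theorem binomialRandom_real_card_layer_le {d θ R η : ℝ} (hd : d = p * Fintype.card V)
    (hd8 : 8 ≤ d) (hθ : 0 ≤ θ) (hθd : θ ≤ d) (i : ℕ)
    (hη : η = d ^ i / Fintype.card V) (hη1 : η ≤ 1 / 20) (s : Finset V) :
    (binomialRandom V p).real {G | ((layer G i s s).card : ℝ) ≤ R * d ^ i ∧
      ∀ l < i, ((layer G l s s).card : ℝ) ≤ 4 * d ^ l} ≤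
      Real.exp (θ * R - θ * (1 - 4 * θ / d - 10 * η) * s.card) := by
  have hd0 : 0 < d := by linarith
  have hn0 : 0 < (Fintype.card V : ℝ) := by
    by_contra h
    have : (Fintype.card V : ℝ) = 0 := le_antisymm (not_lt.1 h) (by positivity)
    rw [this] at hd
    linarith
  have hη0 : 0 ≤ η := by rw [hη]; positivity
  set x : ℕ → ℝ := fun l => θ * d ^ l / d ^ i with hx
  have hx0 l : 0 ≤ x l := by positivity
  have hxs l : x (l + 1) = d * x l := by simp only [hx, pow_succ]; ring
  have hxi : x i = θ := by simp only [hx]; field_simp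
  have hx1 l (hl : l < i) : x l ≤ 1 := by
    simp only [hx]
    rw [div_le_one (by positivity)]
    calc θ * d ^ l ≤ d * d ^ l := by gcongr
      _ = d ^ (l + 1) := by ring
      _ ≤ d ^ i := pow_le_pow_right₀ (by linarith) hl
  set K : ℕ → ℝ := fun l => 4 * d ^ i / d ^ l with hK
  -- This is `2 * K (l + 1)`, which dominates the geometric sum of the caps of all earlier layers.
  set β : ℕ → ℝ := fun l => 8 * d ^ i / d ^ (l + 1) with hβ
  set ν : ℕ → ℝ := fun l => x l * (1 - 4 * x l / d - 10 * η * (1 - (1 / 2) ^ l)) with hν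
  have hpow0 (l : ℕ) : (0 : ℝ) < (1 / 2) ^ l := by positivity
  have hpow1 (l : ℕ) : (1 / 2 : ℝ) ^ l ≤ 1 := pow_le_one₀ (by norm_num) (by norm_num)
  have hdl (l : ℕ) : 1 / d ^ l ≤ (1 / 2) ^ l := by
    rw [one_div_pow]
    exact one_div_le_one_div_of_le (by positivity) (pow_le_pow_left₀ (by norm_num) (by linarith) _)
  have hpK (l : ℕ) : p * K (l + 1) = 4 * η * (1 / d ^ l) := by
    have : (p : ℝ) = d / Fintype.card V := by rw [hd]; field_simp
    rw [this, hη]; simp only [hK, pow_succ]; field_simp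
  have hβn (l : ℕ) : β l = 8 / d * (η * (1 / d ^ l)) * Fintype.card V := by
    rw [hη]; simp only [hβ, pow_succ]; field_simp
  have hν0 l (hl : l < i) : 0 ≤ ν l := by
    have h1 : 4 * x l / d ≤ 1 / 2 := by rw [div_le_iff₀ hd0]; linarith [hx1 l hl]
    have h2 : 10 * η * (1 - (1 / 2) ^ l) ≤ 1 / 2 := by nlinarith [hpow0 l, hpow1 l]
    exact mul_nonneg (hx0 l) (by linarith)
  have key := integral_exploration_le p ν K β i hν0 ?_ ?_ ?_ ?_ (Finset.Subset.refl s) ?_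
  · have := binomialRandom_real_le_of_forall_le p (c := Real.exp (-(θ * R)))
      (s := {G | ((layer G i s s).card : ℝ) ≤ R * d ^ i ∧
        ∀ l < i, ((layer G l s s).card : ℝ) ≤ 4 * d ^ l}) ?_ (Real.exp_pos _) ?_ key
    · rw [← Real.exp_sub] at this
      refine this.trans (Real.exp_le_exp.2 ?_)
      simp only [hν, hxi]
      have h1 : θ * (1 - 4 * θ / d - 10 * η) ≤
          θ * (1 - 4 * θ / d - 10 * η * (1 - (1 / 2) ^ i)) := by
        refine mul_le_mul_of_nonneg_left ?_ hθ
        nlinarith [hpow0 i]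
      have := mul_le_mul_of_nonneg_right h1 (Nat.cast_nonneg (α := ℝ) s.card)
      linarith
    · exact fun G => exploration_nonneg (fun j s => by split_ifs <;> positivity) _ _ _ _
    · rintro G ⟨hG, hGl⟩
      rw [exploration_indicator (c := fun s => Real.exp (-ν 0 * s.card)) K G i s s]
      · refine Real.exp_le_exp.2 ?_
        rw [neg_mul, neg_le_neg_iff]
        have h1 : ν 0 ≤ x 0 := by
          have : 0 ≤ 4 * x 0 / d := by have := hx0 0; positivity
          simp only [hν, pow_zero, sub_self, mul_zero, sub_zero]
          nlinarith [hx0 0]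
        calc ν 0 * (layer G i s s).card ≤ x 0 * (layer G i s s).card := by gcongr
          _ ≤ x 0 * (R * d ^ i) := mul_le_mul_of_nonneg_left hG (hx0 0)
          _ = θ * R := by simp only [hx]; field_simp
      · intro l hl
        refine (hGl l hl).trans_eq ?_
        simp only [hK]
        rw [eq_div_iff (by positivity), mul_assoc, ← pow_add, Nat.add_sub_cancel' hl.le]
  · intro l _
    rw [hpK]
    nlinarith [hdl l, hpow1 l, hpow0 l]
  · intro l _
    have h1 : β (l + 1) = β l / d := by simp only [hβ, pow_succ]; field_simp
    have h2 : K (l + 1) = β l / 2 := by simp only [hβ, hK]; ring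
    have h3 : 0 ≤ β l := by simp only [hβ]; positivity
    have h4 : β l / d ≤ β l / 2 := div_le_div_of_nonneg_left h3 (by norm_num) (by linarith)
    rw [h1, h2]
    linarith
  · intro l _
    rw [hβn]
    have h1 : 8 / d ≤ 1 := by rw [div_le_one hd0]; exact hd8
    have h2 : η * (1 / d ^ l) ≤ 1 := by
      nlinarith [hdl l, hpow1 l, hpow0 l]
    have h3 : 0 ≤ η * (1 / d ^ l) := by positivity
    have : 8 / d * (η * (1 / d ^ l)) ≤ 1 := by nlinarith
    nlinarith
  · intro l hl
    rw [hpK, hβn]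
    have hνs : ν (l + 1) = d * (x l * (1 - 4 * x l - 10 * η * (1 - (1 / 2) ^ l / 2))) := by
      simp only [hν, hxs, pow_succ]; field_simp
    have e2 : (p : ℝ) * (Fintype.card V - 8 / d * (η * (1 / d ^ l)) * Fintype.card V) =
        d * (1 - 8 / d * (η * (1 / d ^ l))) := by rw [hd]; ring
    rw [hνs, e2]
    calc _ ≤ d * (((1 - 8 / d * (η * (1 / d ^ l))) * (1 - 4 * η * (1 / d ^ l))) *
          (1 - Real.exp (-ν l))) :=
          mul_le_mul_of_nonneg_left (exp_neg_recursion hd8 (hx0 l) (hx1 l hl) hη0 hη1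
            (hpow0 l).le (hpow1 l) (by positivity) (hdl l) rfl) hd0.le
      _ = _ := by ring
  · simp only [Finset.sdiff_self, Finset.card_empty, Nat.cast_zero, hβ]
    positivity

end SimpleGraph

/-! ### Spheres as layers, and the vertices that separate a pair. -/

namespace SimpleGraph

variable {V : Type*} [Fintype V]

open Classical in
/-- The vertices at distance at most `l` from the set `X`. -/
noncomputable def ballAround (G : SimpleGraph V) (l : ℕ) (X : Finset V) : Finset V :=
  {y | ∃ x ∈ X, G.edist x y ≤ l}

open Classical in
/-- The vertices at distance exactly `l` from the set `X`. -/
noncomputable def sphereAround (G : SimpleGraph V) (l : ℕ) (X : Finset V) : Finset V :=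
  {y | (∃ x ∈ X, G.edist x y ≤ l) ∧ ∀ x ∈ X, l ≤ G.edist x y}

theorem mem_ballAround {G : SimpleGraph V} {l : ℕ} {X : Finset V} {y : V} :
    y ∈ G.ballAround l X ↔ ∃ x ∈ X, G.edist x y ≤ l := by
  simp [ballAround]

theorem mem_sphereAround {G : SimpleGraph V} {l : ℕ} {X : Finset V} {y : V} :
    y ∈ G.sphereAround l X ↔ (∃ x ∈ X, G.edist x y ≤ l) ∧ ∀ x ∈ X, l ≤ G.edist x y := by
  simp [sphereAround]

/-- The penultimate vertex of a shortest walk from `X` lies on the previous sphere; this identifies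
breadth-first layers with spheres. -/
theorem outerNeighbors_ballAround_sphereAround (G : SimpleGraph V) (l : ℕ) (X : Finset V) :
    G.outerNeighbors (G.ballAround l X) (G.sphereAround l X) = G.sphereAround (l + 1) X := by
  ext y
  simp only [mem_outerNeighbors, mem_ballAround, mem_sphereAround, not_exists, not_and, not_le]
  constructor
  · rintro ⟨h1, z, ⟨⟨x, hx, hxz⟩, _⟩, hzy⟩
    refine ⟨⟨x, hx, ?_⟩, fun x hx => ?_⟩
    · refine (G.edist_triangle (v := z)).trans ?_
      rw [edist_eq_one_iff_adj.2 hzy]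
      push_cast
      gcongr
    · push_cast
      exact Order.add_one_le_of_lt (h1 x hx)
  · rintro ⟨⟨x, hx, hxy⟩, h2⟩
    refine ⟨fun x hx => lt_of_lt_of_le (by exact_mod_cast Nat.lt_succ_self l) (h2 x hx), ?_⟩
    obtain ⟨w, hw⟩ := exists_walk_of_edist_eq_coe (hxy.antisymm (h2 x hx))
    obtain ⟨z, q, hzy, hq⟩ : ∃ z, ∃ q : G.Walk x z, G.Adj z y ∧ q.length = l := by
      have hnil : ¬ w.Nil := by
        rw [← Walk.length_eq_zero_iff]; omega
      refine ⟨w.penultimate, w.dropLast, w.adj_penultimate hnil, ?_⟩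
      rw [Walk.length_dropLast, hw, Nat.add_sub_cancel]
    refine ⟨z, ⟨⟨x, hx, hq ▸ edist_le q⟩, fun x' hx' => ?_⟩, hzy⟩
    have h3 := (h2 x' hx').trans (G.edist_triangle (v := z))
    rw [edist_eq_one_iff_adj.2 hzy] at h3
    push_cast at h3
    exact (ENat.add_le_add_iff_right (by simp)).1 h3

open Classical in
theorem ballAround_union_sphereAround (G : SimpleGraph V) (l : ℕ) (X : Finset V) :
    G.ballAround l X ∪ G.sphereAround (l + 1) X = G.ballAround (l + 1) X := by
  ext y
  simp only [Finset.mem_union, mem_ballAround, mem_sphereAround]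
  constructor
  · rintro (⟨x, hx, h⟩ | h)
    · exact ⟨x, hx, h.trans (by exact_mod_cast Nat.le_succ l)⟩
    · exact h.1
  · intro h
    by_cases h' : ∃ x ∈ X, G.edist x y ≤ l
    · exact Or.inl h'
    · refine Or.inr ⟨h, fun x hx => ?_⟩
      push_cast
      exact Order.add_one_le_of_lt (lt_of_not_ge fun hle => h' ⟨x, hx, hle⟩)

open Classical in
theorem layer_ballAround_sphereAround (G : SimpleGraph V) (j l : ℕ) (X : Finset V) :
    G.layer j (G.ballAround l X) (G.sphereAround l X) = G.sphereAround (l + j) X := by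
  induction j generalizing l with
  | zero => simp [layer]
  | succ j ih =>
    simp only [layer]
    rw [outerNeighbors_ballAround_sphereAround, ballAround_union_sphereAround, ih]
    congr 1
    omega

open Classical in
theorem layer_self (G : SimpleGraph V) (j : ℕ) (X : Finset V) :
    G.layer j X X = G.sphereAround j X := by
  have h1 : G.ballAround 0 X = X := by ext y; simp [mem_ballAround]
  have h2 : G.sphereAround 0 X = X := by ext y; simp [mem_sphereAround]
  have := layer_ballAround_sphereAround G j 0 X
  rwa [h1, h2, zero_add] at this

open Classical in
-- The pair's sphere lies in the union of the two single spheres, and its non-separating vertices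
-- lie in their intersection. Adding the two bounds turns union plus intersection into the sum of
-- the sizes.
theorem two_mul_card_sphereAround_pair_le (G : SimpleGraph V) (i : ℕ) (u v : V) :
    2 * (G.sphereAround i {u, v}).card ≤
      (Finset.univ.filter fun s => G.edist s u ≠ G.edist s v).card +
        (G.sphereAround i {u}).card + (G.sphereAround i {v}).card := by
  have h1 : G.sphereAround i {u, v} ⊆ G.sphereAround i {u} ∪ G.sphereAround i {v} := by
    intro y
    simp only [Finset.mem_union, mem_sphereAround, Finset.mem_insert, Finset.mem_singleton,
      exists_eq_or_imp, exists_eq_left, forall_eq_or_imp, forall_eq]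
    tauto
  have h2 : G.sphereAround i {u, v} ⊆ (Finset.univ.filter fun s => G.edist s u ≠ G.edist s v) ∪
      (G.sphereAround i {u} ∩ G.sphereAround i {v}) := by
    intro y
    simp only [Finset.mem_union, Finset.mem_inter, mem_sphereAround, Finset.mem_insert,
      Finset.mem_singleton, exists_eq_or_imp, exists_eq_left, forall_eq_or_imp, forall_eq,
      Finset.mem_filter, Finset.mem_univ, true_and]
    rintro ⟨h, h3, h4⟩
    by_cases h5 : G.edist y u = G.edist y v
    · rw [edist_comm, G.edist_comm (u := y)] at h5
      rw [h5] at h h3 ⊢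
      exact Or.inr (by tauto)
    · exact Or.inl h5
  have h3 := (Finset.card_le_card h1)
  have h4 := (Finset.card_le_card h2).trans (Finset.card_union_le _ _)
  have h5 := Finset.card_union_add_card_inter (G.sphereAround i {u}) (G.sphereAround i {v})
  omega

open Classical in
theorem card_closedNeighborhood_le (G : SimpleGraph V) (u : V) :
    (Finset.univ.filter fun y => y = u ∨ G.Adj u y).card ≤ 1 + (G.sphereAround 1 {u}).card := by
  have : (Finset.univ.filter fun y => y = u ∨ G.Adj u y) ⊆ {u} ∪ G.sphereAround 1 {u} := by
    intro y
    simp only [Finset.mem_filter, Finset.mem_univ, true_and, Finset.mem_union,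
      Finset.mem_singleton, mem_sphereAround, exists_eq_left, forall_eq]
    rintro (h | h)
    · exact Or.inl h
    · right
      rw [edist_eq_one_iff_adj.2 h]
      simp
  exact (Finset.card_le_card this).trans (Finset.card_union_le _ _)

/-! ### Random sensors and the shrinking set of candidates. -/

open Classical in
/-- Random sensors leave few pairs of vertices of `A` with equal signatures. -/
theorem exists_sensors (G : SimpleGraph V) {k D : ℕ} (hk : k ≤ Fintype.card V)
    (hD : ∀ u v, u ≠ v → D ≤ (Finset.univ.filter fun s => G.edist s u ≠ G.edist s v).card)
    (A : Finset V) :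
    ∃ S : Finset V, S.card = k ∧
      (A.offDiag.filter fun q => ∀ s ∈ S, G.edist s q.1 = G.edist s q.2).card *
        Fintype.card V ^ k ≤ A.card ^ 2 * (Fintype.card V - D) ^ k := by
  -- Sensors are drawn with repetition, so that the count for each pair is a pure `k`-th power.
  set N : (Fin k → V) → ℕ := fun f =>
    (A.offDiag.filter fun q => ∀ i, G.edist (f i) q.1 = G.edist (f i) q.2).card with hN
  have htotal : ∑ f, N f ≤ A.card ^ 2 * (Fintype.card V - D) ^ k := by
    simp only [hN, Finset.card_filter]
    rw [Finset.sum_comm]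
    have hq : ∀ q ∈ A.offDiag,
        ∑ f : Fin k → V, (if ∀ i, G.edist (f i) q.1 = G.edist (f i) q.2 then 1 else 0) ≤
          (Fintype.card V - D) ^ k := by
      intro q hq
      rw [← Finset.card_filter]
      have : (Finset.univ.filter fun f : Fin k → V =>
          ∀ i, G.edist (f i) q.1 = G.edist (f i) q.2) = Fintype.piFinset fun _ : Fin k =>
            Finset.univ.filter fun s => G.edist s q.1 = G.edist s q.2 := by
        ext f
        simp
      rw [this, Fintype.card_piFinset_const]
      refine Nat.pow_le_pow_left ?_ k
      have h1 := hD q.1 q.2 (Finset.mem_offDiag.1 hq).2.2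
      have h2 := Finset.card_filter_add_card_filter_not (s := (Finset.univ : Finset V))
        (fun s => G.edist s q.1 = G.edist s q.2)
      rw [Finset.card_univ] at h2
      simp only [ne_eq] at h1
      omega
    refine (Finset.sum_le_card_nsmul _ _ _ hq).trans ?_
    rw [smul_eq_mul, sq]
    refine Nat.mul_le_mul_right _ ?_
    rw [Finset.offDiag_card]
    exact Nat.sub_le _ _
  obtain ⟨f, hf⟩ : ∃ f : Fin k → V, N f * Fintype.card V ^ k ≤
      A.card ^ 2 * (Fintype.card V - D) ^ k := by
    by_contra! h
    have hne : Nonempty (Fin k → V) := by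
      rcases Nat.eq_zero_or_pos k with rfl | hk0
      · exact ⟨Fin.elim0⟩
      · have := Fintype.card_pos_iff.1 (hk0.trans_le hk)
        infer_instance
    have h1 : ∑ _f : Fin k → V, A.card ^ 2 * (Fintype.card V - D) ^ k <
        ∑ f : Fin k → V, N f * Fintype.card V ^ k :=
      Finset.sum_lt_sum_of_nonempty Finset.univ_nonempty fun f _ => h f
    rw [Finset.sum_const, ← Finset.sum_mul, Finset.card_univ, Fintype.card_fun, Fintype.card_fin,
      smul_eq_mul, mul_comm] at h1
    exact absurd (Nat.mul_le_mul_right (Fintype.card V ^ k) htotal) (not_le.2 h1)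
  -- Repeated draws may give fewer than `k` sensors; adding more can only resolve further pairs.
  obtain ⟨S, hS, hSk⟩ := Finset.exists_superset_card_eq (s := Finset.univ.image f) (n := k)
    (Finset.card_image_le.trans (by simp)) hk
  refine ⟨S, hSk, le_trans (Nat.mul_le_mul_right _ (Finset.card_le_card ?_)) hf⟩
  intro q
  simp only [Finset.mem_filter]
  exact fun h => ⟨h.1, fun i => h.2 _ (hS (by simp))⟩

end SimpleGraph

open Classical in
/-- The vertices of `A` that are consistent with the observation `o`. -/
noncomputable def consistent {V : Type*} [Fintype V] (G : SimpleGraph V) (A : Finset V)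
    (o : Observation V) : Finset V :=
  A.filter fun v => signature G o.1 v = o.2

open Classical in
/-- The possible positions before the observation of a round, given the earlier observations. -/
noncomputable def candidates {V : Type*} [Fintype V] (G : SimpleGraph V)
    (h : List (Observation V)) : Finset V :=
  h.foldl (fun A o => (consistent G A o).biUnion fun u => {y | y = u ∨ G.Adj u y}) Finset.univ

theorem mem_candidates_infoTrail {V : Type*} [Fintype V] (G : SimpleGraph V) (σ : CopRule V)
    {w : ℕ → V} (hw : IsRobberWalk G w) (t : ℕ) : w t ∈ candidates G (infoTrail G σ w t) := by
  induction t with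
  | zero => simp [candidates, infoTrail]
  | succ t ih =>
    simp only [candidates, infoTrail, List.foldl_append, List.foldl_cons, List.foldl_nil,
      Finset.mem_biUnion, Finset.mem_filter, Finset.mem_univ, true_and, consistent]
    exact ⟨w t, ⟨ih, rfl⟩, hw t⟩

open Classical in
/-- The cops win if they can always place the sensors such that the set of possible positions
of the robber shrinks or has only one element. -/
theorem copsCanWin_of_shrinking {V : Type*} [Fintype V] (G : SimpleGraph V) {k : ℕ}
    (h : ∀ A : Finset V, ∃ S : Finset V, S.card = k ∧ ∀ C ⊆ A,
      (∀ u ∈ C, ∀ v ∈ C, ∀ s ∈ S, G.edist s u = G.edist s v) → 2 ≤ C.card →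
        (C.biUnion fun u => {y | y = u ∨ G.Adj u y}).card < A.card) : CopsCanWin G k := by
  choose S hSk hS using h
  refine ⟨fun h => S (candidates G h), fun h => hSk _, fun w hw => ?_⟩
  set σ : CopRule V := fun h => S (candidates G h) with hσ
  set A : ℕ → Finset V := fun t => candidates G (infoTrail G σ w t) with hA
  set C : ℕ → Finset V := fun t => consistent G (A t)
    ⟨σ (infoTrail G σ w t), signature G (σ (infoTrail G σ w t)) (w t)⟩ with hC
  have hsucc (t : ℕ) : A (t + 1) = (C t).biUnion fun u => {y | y = u ∨ G.Adj u y} := by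
    simp only [hA, hC, candidates, infoTrail, List.foldl_append, List.foldl_cons, List.foldl_nil]
  have hex : ∃ t, (C t).card ≤ 1 := by
    by_contra! hcon
    have hlt (t : ℕ) : (A (t + 1)).card < (A t).card := by
      rw [hsucc]
      refine hS (A t) (C t) (Finset.filter_subset _ _) ?_ (hcon t)
      intro u hu v hv s hs
      have h1 := (Finset.mem_filter.1 hu).2.trans (Finset.mem_filter.1 hv).2.symm
      exact congrFun h1 ⟨s, hs⟩
    have hle (t : ℕ) : (A t).card + t ≤ (A 0).card := by
      induction t with
      | zero => rfl
      | succ t ih => have := hlt t; omega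
    have := hle ((A 0).card + 1)
    omega
  obtain ⟨t, ht⟩ := hex
  refine ⟨t, fun x hx hxw => ?_⟩
  simp only [infoTrail] at hxw
  obtain ⟨h1, h2⟩ := List.append_inj' hxw rfl
  have hmem (y : ℕ → V) (hy : IsRobberWalk G y) (hyt : infoTrail G σ y t = infoTrail G σ w t)
      (hsig : signature G (σ (infoTrail G σ w t)) (y t) =
        signature G (σ (infoTrail G σ w t)) (w t)) : y t ∈ C t := by
    refine Finset.mem_filter.2 ⟨?_, hsig⟩
    have := mem_candidates_infoTrail G σ hy t
    rwa [hyt] at this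
  refine Finset.card_le_one.1 ht _ (hmem x hx h1 ?_) _ (hmem w hw rfl rfl)
  rw [h1] at h2
  simpa using h2

open Classical in
theorem copsCanWin_of_separation {V : Type*} [Fintype V] (G : SimpleGraph V) {k D Δ : ℕ}
    (hk : k ≤ Fintype.card V)
    (hD : ∀ u v, u ≠ v → D ≤ (Finset.univ.filter fun s => G.edist s u ≠ G.edist s v).card)
    (hΔ : ∀ u, (Finset.univ.filter fun y => y = u ∨ G.Adj u y).card ≤ Δ)
    (h : 2 * Δ ^ 2 * (Fintype.card V - D) ^ k < Fintype.card V ^ k) : CopsCanWin G k := by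
  refine copsCanWin_of_shrinking G fun A => ?_
  obtain ⟨S, hSk, hS⟩ := G.exists_sensors hk hD A
  refine ⟨S, hSk, fun C hCA hC hC2 => ?_⟩
  have hoff : C.offDiag ⊆ A.offDiag.filter fun q => ∀ s ∈ S, G.edist s q.1 = G.edist s q.2 := by
    intro q hq
    obtain ⟨h1, h2, h3⟩ := Finset.mem_offDiag.1 hq
    exact Finset.mem_filter.2 ⟨Finset.mem_offDiag.2 ⟨hCA h1, hCA h2, h3⟩, hC _ h1 _ h2⟩
  have h1 := Finset.card_le_card hoff
  rw [Finset.offDiag_card] at h1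
  have h2 : C.card ^ 2 ≤ 2 * (C.card * C.card - C.card) := by
    obtain ⟨m, hm⟩ := Nat.exists_eq_add_of_le hC2
    rw [hm, show (2 + m) * (2 + m) - (2 + m) = (2 + m) * (1 + m) by
      rw [Nat.sub_eq_iff_eq_add (Nat.le_mul_self _)]; ring]
    nlinarith
  have h3 : (C.biUnion fun u => (Finset.univ.filter fun y => y = u ∨ G.Adj u y)).card ≤
      C.card * Δ := Finset.card_biUnion_le_card_mul _ _ _ fun u _ => hΔ u
  have hA0 : 0 < A.card := lt_of_lt_of_le (by omega) (Finset.card_le_card hCA)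
  refine lt_of_pow_lt_pow_left₀ 2 (Nat.zero_le _) ?_
  refine lt_of_mul_lt_mul_right (a := Fintype.card V ^ k) ?_ (Nat.zero_le _)
  calc _ ≤ (C.card * Δ) ^ 2 * Fintype.card V ^ k :=
        Nat.mul_le_mul_right _ (Nat.pow_le_pow_left h3 2)
    _ = Δ ^ 2 * (C.card ^ 2 * Fintype.card V ^ k) := by ring
    _ ≤ Δ ^ 2 * (2 * ((A.offDiag.filter fun q => ∀ s ∈ S, G.edist s q.1 = G.edist s q.2).card *
          Fintype.card V ^ k)) := by
        refine Nat.mul_le_mul_left _ ?_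
        rw [← mul_assoc]
        exact Nat.mul_le_mul_right _ (h2.trans (Nat.mul_le_mul_left 2 h1))
    _ ≤ Δ ^ 2 * (2 * (A.card ^ 2 * (Fintype.card V - D) ^ k)) := by gcongr
    _ = A.card ^ 2 * (2 * Δ ^ 2 * (Fintype.card V - D) ^ k) := by ring
    _ < _ := Nat.mul_lt_mul_of_pos_left h (by positivity)

/-! ### Regularity of spheres in the random graph and its consequence for the game. -/

namespace SimpleGraph

variable {V : Type*} [Fintype V]

open Classical in
/-- The spheres of radius `i` about one or two vertices have about the expected sizes, and the
degrees are at most `4 * d`. -/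
def IsSphereRegular (G : SimpleGraph V) (d δ : ℝ) (i : ℕ) : Prop :=
  (∀ u, ((G.sphereAround i {u}).card : ℝ) < (1 + δ) * d ^ i) ∧
    (∀ u, ((G.sphereAround 1 {u}).card : ℝ) < 4 * d ^ 1) ∧
    ∀ u v, u ≠ v → 2 * (1 - δ) * d ^ i < (G.sphereAround i {u, v}).card

variable (p : unitInterval)

open Classical in
theorem binomialRandom_real_four_mul_pow_le {d : ℝ} (hd : d = p * Fintype.card V) (hd8 : 8 ≤ d)
    (hdn : 64 * Real.log (Fintype.card V) ≤ d) (l : ℕ) {X : Finset V} (hX : X.card ≤ 2) :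
    (binomialRandom V p).real {G | 4 * d ^ l ≤ ((G.sphereAround l X).card : ℝ)} ≤
      Real.exp (-(4 * Real.log (Fintype.card V))) := by
  -- The exponent is at most `(d / 8) * (3 / 2 * 2 - 4) = -d / 8`.
  have := binomialRandom_real_le_card_layer p (R := 4) hd hd8 (θ := d / 8) (by linarith)
    (by linarith) l (Finset.Subset.refl X)
  simp only [layer_self] at this
  refine this.trans (Real.exp_le_exp.2 ?_)
  have h1 : 4 * (d / 8) / d = 1 / 2 := by field_simp; norm_num
  have h2 : (X.card : ℝ) ≤ 2 := by exact_mod_cast hX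
  rw [h1]
  nlinarith

open Classical in
theorem binomialRandom_real_not_isSphereRegular_le {d δ η : ℝ} (hd : d = p * Fintype.card V)
    (hd8 : 8 ≤ d) (i : ℕ) (hη : η = d ^ i / Fintype.card V) (hδ1 : δ ≤ 1)
    (hηδ : 40 * η ≤ δ) (hη1 : η ≤ 1 / 20)
    (hδd : 64 * Real.log (Fintype.card V) ≤ δ ^ 2 * d) :
    (binomialRandom V p).real {G | ¬ G.IsSphereRegular d δ i} ≤ 5 / Fintype.card V := by
  have hd0 : 0 < d := by linarith
  have hn0 : 0 < (Fintype.card V : ℝ) := by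
    by_contra h
    have : (Fintype.card V : ℝ) = 0 := le_antisymm (not_lt.1 h) (by positivity)
    rw [this] at hd
    linarith
  have hn1 : 1 ≤ (Fintype.card V : ℝ) := by
    have : 0 < Fintype.card V := by exact_mod_cast hn0
    exact_mod_cast this
  have hη0 : 0 ≤ η := by rw [hη]; positivity
  have hδ0 : 0 ≤ δ := by linarith
  have hδ2 : δ ^ 2 ≤ 1 := pow_le_one₀ hδ0 hδ1
  have hdn : 64 * Real.log (Fintype.card V) ≤ d := by nlinarith
  -- Since `2 ^ i ≤ d ^ i ≤ n`, the union bound over radii costs at most a factor `n`.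
  have hin : (i : ℝ) ≤ Fintype.card V := by
    have h1 : (i : ℝ) ≤ 2 ^ i := by exact_mod_cast Nat.lt_two_pow_self.le
    have h2 : (2 : ℝ) ^ i ≤ d ^ i := pow_le_pow_left₀ (by norm_num) (by linarith) i
    have h3 : d ^ i = η * Fintype.card V := by rw [hη]; field_simp
    nlinarith
  set q := Real.exp (-(4 * Real.log (Fintype.card V))) with hq
  have hqn : q = 1 / (Fintype.card V : ℝ) ^ 4 := by
    rw [hq, Real.exp_neg, one_div, show (4 : ℝ) * Real.log (Fintype.card V) =
      (4 : ℕ) * Real.log (Fintype.card V) by norm_num, Real.exp_nat_mul, Real.exp_log hn0]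
  have hq0 : 0 < q := Real.exp_pos _
  have card2 (u v : V) : ({u, v} : Finset V).card ≤ 2 := Finset.card_le_two
  have hA (u : V) : (binomialRandom V p).real
      {G | (1 + δ) * d ^ i ≤ ((G.sphereAround i {u}).card : ℝ)} ≤ q := by
    have := binomialRandom_real_le_card_layer p (R := 1 + δ) hd hd8 (θ := δ * d / 8)
      (by positivity) (by nlinarith) i (Finset.Subset.refl {u})
    simp only [layer_self] at this
    refine this.trans (Real.exp_le_exp.2 ?_)
    have h1 : 4 * (δ * d / 8) / d = δ / 2 := by field_simp; ring
    rw [h1, Finset.card_singleton]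
    push_cast
    nlinarith
  have hC (u v : V) (huv : u ≠ v) : (binomialRandom V p).real
      {G | ((G.sphereAround i {u, v}).card : ℝ) ≤ 2 * (1 - δ) * d ^ i ∧
        ∀ l < i, ((G.sphereAround l {u, v}).card : ℝ) ≤ 4 * d ^ l} ≤ q := by
    -- The exponent is `θ * (20 * η - 3 / 2 * δ) ≤ -θ * δ = -δ² * d / 16`, by `40 * η ≤ δ`.
    have := binomialRandom_real_card_layer_le p (R := 2 * (1 - δ)) hd hd8 (θ := δ * d / 16)
      (by positivity) (by nlinarith) i hη hη1 {u, v}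
    simp only [layer_self] at this
    refine this.trans (Real.exp_le_exp.2 ?_)
    have h1 : 4 * (δ * d / 16) / d = δ / 4 := by field_simp; ring
    rw [h1, Finset.card_pair huv]
    push_cast
    have h2 : 0 ≤ δ * d * (δ - 40 * η) := mul_nonneg (by positivity) (by linarith)
    nlinarith
  have hsub : {G : SimpleGraph V | ¬ G.IsSphereRegular d δ i} ⊆
      ((⋃ u ∈ (Finset.univ : Finset V),
          {G | (1 + δ) * d ^ i ≤ ((G.sphereAround i {u}).card : ℝ)}) ∪
        (⋃ u ∈ (Finset.univ : Finset V),
          {G | 4 * d ^ 1 ≤ ((G.sphereAround 1 {u}).card : ℝ)})) ∪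
      ((⋃ e ∈ (Finset.univ : Finset V).offDiag ×ˢ Finset.range i,
          {G | 4 * d ^ e.2 ≤ ((G.sphereAround e.2 {e.1.1, e.1.2}).card : ℝ)}) ∪
        (⋃ e ∈ (Finset.univ : Finset V).offDiag,
          {G | ((G.sphereAround i {e.1, e.2}).card : ℝ) ≤ 2 * (1 - δ) * d ^ i ∧
            ∀ l < i, ((G.sphereAround l {e.1, e.2}).card : ℝ) ≤ 4 * d ^ l})) := by
    intro G hG
    by_contra hcon
    simp only [Set.mem_union, Set.mem_iUnion, Set.mem_ofPred_eq, not_or, not_exists, not_le,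
      Finset.mem_univ, forall_true_left, Finset.mem_product, Finset.mem_offDiag, Finset.mem_range,
      true_and, Prod.forall, ne_eq, and_imp, not_and, not_forall] at hcon
    obtain ⟨⟨h1, h2⟩, h3, h4⟩ := hcon
    refine hG ⟨h1, h2, fun u v huv => ?_⟩
    by_contra hle
    obtain ⟨l, hl, hl'⟩ := h4 u v huv (not_lt.1 hle)
    exact absurd (h3 u v l huv hl) hl'.not_gt
  have hoff : ((Finset.univ : Finset V).offDiag.card : ℝ) ≤ (Fintype.card V : ℝ) ^ 2 := by
    rw [Finset.offDiag_card, Finset.card_univ, sq]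
    exact_mod_cast Nat.sub_le _ _
  have hb {ι : Type _} (s : Finset ι) (A : ι → Set (SimpleGraph V))
      (h : ∀ e ∈ s, (binomialRandom V p).real (A e) ≤ q) :
      (binomialRandom V p).real (⋃ e ∈ s, A e) ≤ s.card * q :=
    (measureReal_biUnion_finset_le _ _).trans (by
      simpa [nsmul_eq_mul] using Finset.sum_le_card_nsmul s _ q h)
  have b1 := hb Finset.univ _ fun u _ => hA u
  have b2 := hb Finset.univ _ fun u _ => binomialRandom_real_four_mul_pow_le p hd hd8 hdn 1
    (X := {u}) (by simp)
  have b3 := hb ((Finset.univ : Finset V).offDiag ×ˢ Finset.range i) _ fun e _ =>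
    binomialRandom_real_four_mul_pow_le p hd hd8 hdn e.2 (card2 e.1.1 e.1.2)
  have b4 := hb (Finset.univ : Finset V).offDiag _ fun e he =>
    hC e.1 e.2 (Finset.mem_offDiag.1 he).2.2
  have hu := (measureReal_mono (μ := binomialRandom V p) hsub).trans
    ((measureReal_union_le _ _).trans
      (add_le_add ((measureReal_union_le _ _).trans (add_le_add b1 b2))
        ((measureReal_union_le _ _).trans (add_le_add b3 b4))))
  refine hu.trans ?_
  rw [Finset.card_univ, Finset.card_product, Finset.card_range]
  push_cast
  set n : ℝ := (Fintype.card V : ℝ)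
  have hn2 : n ≤ n ^ 2 := by nlinarith
  have hn3 : n ^ 2 ≤ n ^ 3 := by nlinarith [sq_nonneg n]
  have h5 : ((Finset.univ : Finset V).offDiag.card : ℝ) * i ≤ n ^ 3 := by
    calc _ ≤ n ^ 2 * n := by gcongr
      _ = n ^ 3 := by ring
  calc _ = (n + n + ((Finset.univ : Finset V).offDiag.card * i +
        (Finset.univ : Finset V).offDiag.card)) * q := by ring
    _ ≤ (5 * n ^ 3) * q := by
        refine mul_le_mul_of_nonneg_right ?_ hq0.le
        linarith
    _ = 5 / n := by rw [hqn]; field_simp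

open Classical in
theorem IsSphereRegular.localizationNumber_le {G : SimpleGraph V} {d δ η L B : ℝ} {i : ℕ}
    (hG : G.IsSphereRegular d δ i) (hd1 : 1 ≤ d) (hη : η = d ^ i / Fintype.card V) (hη1 : η ≤ 1)
    (hδ0 : 0 ≤ δ) (hδ : δ ≤ 1 / 6) (hL : 0 ≤ L)
    (hLd : 50 * d ^ 2 * Real.exp 2 < Real.exp (2 * L))
    (hB : B = (1 + 6 * δ) * L * (Fintype.card V / d ^ i)) :
    (localizationNumber G : ℝ) ≤ B := by
  obtain ⟨h1, h2, h3⟩ := hG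
  set n := Fintype.card V with hn
  have hle {k : ℕ} (h : CopsCanWin G k) : localizationNumber G ≤ k := Nat.sInf_le h
  rcases le_or_gt (n : ℝ) B with hnB | hnB
  · exact le_trans (by exact_mod_cast hle (copsCanWin_card G)) hnB
  have hd0 : 0 < d := by linarith
  have hB0 : 0 ≤ B := by rw [hB]; positivity
  have hn0 : 0 < (n : ℝ) := lt_of_le_of_lt hB0 hnB
  set k := ⌊B⌋₊ with hk
  have hkB : (k : ℝ) ≤ B := Nat.floor_le hB0
  have hBk : B - 1 ≤ k := (Nat.sub_one_lt_floor B).le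
  set D := ⌈2 * (1 - 3 * δ) * d ^ i⌉₊ with hD
  have hDd : 2 * (1 - 3 * δ) * d ^ i ≤ D := Nat.le_ceil _
  refine le_trans (Nat.cast_le.2 (hle (copsCanWin_of_separation G (k := k) (D := D)
    (Δ := ⌊5 * d⌋₊) (by exact_mod_cast hkB.trans hnB.le) ?_ ?_ ?_))) hkB
  · intro u v huv
    rw [hD, Nat.ceil_le]
    have h4 : (2 * (G.sphereAround i {u, v}).card : ℝ) ≤
        (Finset.univ.filter fun s => G.edist s u ≠ G.edist s v).card +
          (G.sphereAround i {u}).card + (G.sphereAround i {v}).card := by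
      exact_mod_cast G.two_mul_card_sphereAround_pair_le i u v
    linarith [h1 u, h1 v, h3 u v huv]
  · intro u
    refine Nat.le_floor ?_
    have h4 : ((Finset.univ.filter fun y => y = u ∨ G.Adj u y).card : ℝ) ≤
        1 + (G.sphereAround 1 {u}).card := by exact_mod_cast G.card_closedNeighborhood_le u
    linarith [h2 u]
  · have hcast : (((n - D : ℕ) : ℝ)) ≤ n * Real.exp (-(D / n)) := by
      rcases le_or_gt D n with h | h
      · rw [Nat.cast_sub h]
        have := Real.add_one_le_exp (-((D : ℝ) / n))
        calc (n : ℝ) - D = n * (-((D : ℝ) / n) + 1) := by field_simp; ring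
          _ ≤ _ := mul_le_mul_of_nonneg_left this hn0.le
      · rw [Nat.sub_eq_zero_of_le h.le, Nat.cast_zero]
        positivity
    -- For `δ ≤ 1 / 6`, `(1 - 3 * δ) * (1 + 6 * δ) ≥ 1`; rounding `B` down to `k` costs at most 2,
    -- because `η ≤ 1`.
    have hexp : 2 * L - 2 ≤ k * (D / n) := by
      have hη0 : 0 ≤ η := by rw [hη]; positivity
      have hD' : 2 * (1 - 3 * δ) * η ≤ D / n := by
        rw [hη, ← mul_div_assoc]
        exact div_le_div_of_nonneg_right hDd hn0.le
      have hBη : B * η = (1 + 6 * δ) * L := by rw [hB, hη]; field_simp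
      have h3δ : 0 ≤ 2 * (1 - 3 * δ) * η := mul_nonneg (by linarith) hη0
      calc 2 * L - 2 ≤ 2 * (1 - 3 * δ) * ((1 + 6 * δ) * L) - 2 * (1 - 3 * δ) * η := by
            have h5 : 0 ≤ L * (δ * (1 - 6 * δ)) :=
              mul_nonneg hL (mul_nonneg hδ0 (by linarith))
            nlinarith
        _ = (B - 1) * (2 * (1 - 3 * δ) * η) := by rw [← hBη]; ring
        _ ≤ k * (2 * (1 - 3 * δ) * η) := mul_le_mul_of_nonneg_right hBk h3δ
        _ ≤ _ := mul_le_mul_of_nonneg_left hD' (by positivity)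
    have hfl : (⌊5 * d⌋₊ : ℝ) ≤ 5 * d := Nat.floor_le (by positivity)
    have : (2 * (⌊5 * d⌋₊ : ℝ) ^ 2 * ((n - D : ℕ) : ℝ) ^ k) < (n : ℝ) ^ k := by
      calc _ ≤ 2 * (5 * d) ^ 2 * (n * Real.exp (-(D / n))) ^ k := by gcongr
        _ = 50 * d ^ 2 * Real.exp (-(k * (D / n))) * n ^ k := by
            rw [mul_pow (n : ℝ), ← Real.exp_nat_mul, mul_neg]; ring
        _ ≤ 50 * d ^ 2 * Real.exp (2 - 2 * L) * n ^ k := by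
            gcongr
            linarith
        _ = (50 * d ^ 2 * Real.exp 2 / Real.exp (2 * L)) * n ^ k := by
            rw [Real.exp_sub]; ring
        _ < 1 * n ^ k := by
            refine mul_lt_mul_of_pos_right ?_ (by positivity)
            rwa [div_lt_one (Real.exp_pos _)]
        _ = _ := one_mul _
    exact_mod_cast this

end SimpleGraph

/-! ### The asymptotic statement. -/

theorem theorem6p1 (p : ℕ → unitInterval) (d : ℕ → ℝ) (hd : ∀ n, d n = (p n : ℝ) * (n : ℝ))
    (hd_lower : (fun n : ℕ => Real.log (n : ℝ)) =o[Filter.atTop] d)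
    (hd_upper : d =o[Filter.atTop] (fun n : ℕ => (n : ℝ)))
    (i : ℕ → ℕ) (hi : IsLargestExponent d i)
    (hdiam : Filter.Tendsto (fun n : ℕ => d n ^ (i n + 1) / (n : ℝ) - 2 * Real.log (n : ℝ))
      Filter.atTop Filter.atTop) :
    ∃ ε : ℕ → ℝ, Filter.Tendsto ε Filter.atTop (nhds 0) ∧
      Filter.Tendsto
        (fun n : ℕ => SimpleGraph.binomialRandom (Fin n) (p n)
          {G : SimpleGraph (Fin n) | (localizationNumber G : ℝ) ≤
            (1 + ε n) * (Real.log (d n) + 2 * Real.log (Real.log (n : ℝ))) *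
              ((n : ℝ) / d n ^ i n)})
        Filter.atTop (nhds 1) := by
  have hlog : Filter.Tendsto (fun n : ℕ => Real.log (n : ℝ)) Filter.atTop Filter.atTop :=
    Real.tendsto_log_atTop.comp tendsto_natCast_atTop_atTop
  have hη : Filter.Tendsto (fun n : ℕ => d n ^ i n / (n : ℝ)) Filter.atTop (nhds 0) :=
    hi.1.tendsto_div_nhds_zero
  have hld : Filter.Tendsto (fun n : ℕ => Real.log (n : ℝ) / d n) Filter.atTop (nhds 0) :=
    hd_lower.tendsto_div_nhds_zero
  -- The summands secure `40 * η ≤ δ` and `64 * log n ≤ δ² * d` respectively, and both tend to 0.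
  set δ : ℕ → ℝ := fun n =>
    40 * (d n ^ i n / (n : ℝ)) + Real.sqrt (64 * (Real.log (n : ℝ) / d n)) with hδdef
  have hδ : Filter.Tendsto δ Filter.atTop (nhds 0) := by
    have h1 := (hη.const_mul 40).add ((Real.continuous_sqrt.tendsto _).comp (hld.const_mul 64))
    rw [mul_zero, mul_zero, Real.sqrt_zero, add_zero] at h1
    exact h1
  refine ⟨fun n => 6 * δ n, by simpa using hδ.const_mul 6, ?_⟩
  have hmain : ∀ᶠ n : ℕ in Filter.atTop, 1 - ENNReal.ofReal (5 / (n : ℝ)) ≤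
      SimpleGraph.binomialRandom (Fin n) (p n)
          {G : SimpleGraph (Fin n) | (localizationNumber G : ℝ) ≤
            (1 + 6 * δ n) * (Real.log (d n) + 2 * Real.log (Real.log (n : ℝ))) *
              ((n : ℝ) / d n ^ i n)} := by
    filter_upwards [hη.eventually_le_const (by norm_num : (0 : ℝ) < 1 / 20),
      hδ.eventually_le_const (by norm_num : (0 : ℝ) < 1 / 6), hd_lower.bound one_pos,
      hlog.eventually_ge_atTop 8] with n hη1 hδ1 hlow hlog8
    have hd0 : 0 ≤ d n := by
      rw [hd]
      exact mul_nonneg (p n).2.1 (Nat.cast_nonneg n)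
    rw [one_mul, Real.norm_of_nonneg (by linarith), Real.norm_of_nonneg hd0] at hlow
    have hd8 : 8 ≤ d n := hlog8.trans hlow
    have hdpos : 0 < d n := by linarith
    have hη0 : 0 ≤ d n ^ i n / (n : ℝ) := by positivity
    have hsq : 0 ≤ Real.sqrt (64 * (Real.log (n : ℝ) / d n)) := Real.sqrt_nonneg _
    have hlogpos : 0 < Real.log n := by linarith
    have hdcard : d n = p n * (Fintype.card (Fin n) : ℝ) := by rw [hd, Fintype.card_fin]
    have hηcard : d n ^ i n / (n : ℝ) = d n ^ i n / (Fintype.card (Fin n) : ℝ) := by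
      rw [Fintype.card_fin]
    have hbad := SimpleGraph.binomialRandom_real_not_isSphereRegular_le (V := Fin n) (p n)
      (δ := δ n) hdcard hd8 (i n) hηcard (by linarith) (by simp only [hδdef]; linarith) hη1 (by
        rw [Fintype.card_fin]
        have h1 : Real.sqrt (64 * (Real.log (n : ℝ) / d n)) ^ 2 ≤ δ n ^ 2 :=
          pow_le_pow_left₀ hsq (by simp only [hδdef]; linarith) 2
        rw [Real.sq_sqrt (by positivity)] at h1
        calc 64 * Real.log n = 64 * (Real.log n / d n) * d n := by field_simp
          _ ≤ _ := mul_le_mul_of_nonneg_right h1 hd0)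
    rw [Fintype.card_fin] at hbad
    have hgood : {G : SimpleGraph (Fin n) | ¬ G.IsSphereRegular (d n) (δ n) (i n)}ᶜ ⊆
        {G : SimpleGraph (Fin n) | (localizationNumber G : ℝ) ≤
            (1 + 6 * δ n) * (Real.log (d n) + 2 * Real.log (Real.log (n : ℝ))) *
              ((n : ℝ) / d n ^ i n)} := by
      intro G hG
      simp only [Set.mem_compl_iff, Set.mem_ofPred_eq, not_not] at hG
      have hL1 : 0 ≤ Real.log (d n) := Real.log_nonneg (by linarith)
      have hL2 : 0 ≤ Real.log (Real.log n) := Real.log_nonneg (by linarith)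
      refine hG.localizationNumber_le (L := Real.log (d n) + 2 * Real.log (Real.log n))
        (by linarith) hηcard (by linarith) (by simp only [hδdef]; linarith) hδ1 (by linarith) ?_ (by rw [Fintype.card_fin])
      -- The factor `(log n)⁴ ≥ 8⁴` exceeds the constant `50 * exp 2 < 450`.
      have e1 : Real.exp (2 * (Real.log (d n) + 2 * Real.log (Real.log n))) =
          d n ^ 2 * Real.log n ^ 4 := by
        rw [show 2 * (Real.log (d n) + 2 * Real.log (Real.log n)) =
          (2 : ℕ) * Real.log (d n) + (4 : ℕ) * Real.log (Real.log n) by push_cast; ring,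
          Real.exp_add, Real.exp_nat_mul, Real.exp_nat_mul, Real.exp_log hdpos,
          Real.exp_log hlogpos]
      rw [e1]
      have e2 : Real.exp 2 < 9 := by
        rw [show (2 : ℝ) = 1 + 1 by norm_num, Real.exp_add]
        nlinarith [Real.exp_one_lt_three, Real.exp_pos 1]
      have e3 : (8 : ℝ) ^ 4 ≤ Real.log n ^ 4 := pow_le_pow_left₀ (by norm_num) hlog8 4
      have e4 : 0 < d n ^ 2 := by positivity
      nlinarith
    refine le_trans ?_ (MeasureTheory.measure_mono hgood)
    rw [MeasureTheory.prob_compl_eq_one_sub MeasurableSet.of_discrete]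
    refine tsub_le_tsub_left ?_ 1
    rw [← MeasureTheory.ofReal_measureReal]
    exact ENNReal.ofReal_le_ofReal hbad
  refine tendsto_of_tendsto_of_tendsto_of_le_of_le' ?_ tendsto_const_nhds hmain
    (.of_forall fun n => MeasureTheory.prob_le_one)
  have h5 : Filter.Tendsto (fun n : ℕ => ENNReal.ofReal (5 / (n : ℝ))) Filter.atTop (nhds 0) := by
    have := ENNReal.tendsto_ofReal (tendsto_const_div_atTop_nhds_zero_nat (5 : ℝ))
    simpa using this
  simpa using ENNReal.Tendsto.sub (tendsto_const_nhds (x := (1 : ENNReal))) h5 (Or.inl (by simp))
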